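/- **Setting.** Let $\eta,d$ be natural numbers. An *oracle family* is $\mathcal Q=(Q_1,\dots,Q_\eta)$, where each $Q_j$ is a $d\times d$ unitary matrix all of whose eigenvalues lie in $\{1,-1\}$; for real $\alpha$ let $Q_j^{\alpha}=\tfrac12(\mathbb 1+Q_j)+e^{-i\pi\alpha}\,\tfrac12(\mathbb 1-Q_j)$. A *fractional-query algorithm* with cost $T$ consists of unitaries $U_0,\dots,U_\lambda$ on $\mathbb C^d$, indices $i_1,\dots,i_\lambda\in\{1,\dots,\eta\}$ and exponents $0<\alpha_k\le 1$ with $\sum_{k=1}^\lambda\alpha_k=T$, all independent of the oracles. Run on $\mathcal Q$ it performs $$U(\mathcal Q)=U_\lambda\,Q_{i_\lambda}^{\alpha_\lambda}\,U_{\lambda-1}\cdots U_1\,Q_{i_1}^{\alpha_1}\,U_0 .$$ Let $Q=\sum_{j=1}^{\eta}|j\rangle\langle j|\otimes Q_j$ on $\mathbb C^\eta\otimes\mathbb C^d$. A *circuit making $k$ queries to $Q$* acts on $\mathcal W\otimes\mathbb C^2\otimes\mathbb C^\eta\otimes\mathbb C^d$, where $\mathcal W$ is a finite-dimensional work space, and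 is a product $W_k\hat QW_{k-1}\cdots W_1\hat QW_0$, where the unitaries $W_0,\dots,W_k$ are independent of the oracles and $\hat Q=\mathbb 1_{\mathcal W}\otimes\bigl(|0\rangle\langle0|\otimes\mathbb 1+|1\rangle\langle1|\otimes Q\bigr)$ is the controlled query to $Q$. It *implements* a unitary $U$ on $\mathbb C^d$ *with error at most $\epsilon$* if, for a fixed computational basis state $|\mathrm{init}\rangle$ of $\mathcal W\otimes\mathbb C^2\otimes\mathbb C^\eta$ independent of the oracles, it maps $|\mathrm{init}\rangle|\psi\rangle$ to a vector within Euclidean distance $\epsilon$ of $|\mathrm{init}\rangle U|\psi\rangle$, for every unit vector $|\psi\rangle\in\mathbb C^d$. **Theorem (Multiple-query model).** There is an absolute constant $K>0$ such that for all $\eta,d$, every fractional-query algorithm over $\eta$ oracles on $\mathbb C^d$ with cost $T\ge 1$, and every $\epsilon>0$ with $T/\epsilon>e$, there is a circuit that makes at most $$K\,T\,\frac{\log(T/\epsilon)}{\log\log(T/\epsilon)}$$ queries to $Q$ and that, for every oracle family $\mathcal Q=(Q_1,\dots,Q_\eta)$ of $d\times d$ unitaries with eigenvalues $\pm1$, implements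 $U(\mathcal Q)$ with error at most $\epsilon$. -/

import Mathlib

open scoped Kronecker

noncomputable section

/-- The oracles of the model: unitary matrices all of whose eigenvalues are `1` or `-1`. -/
def IsSignOracle {d : ℕ} (Q : Matrix (Fin d) (Fin d) ℂ) : Prop :=
  Q ∈ Matrix.unitaryGroup (Fin d) ℂ ∧ spectrum ℂ Q ⊆ {1, -1}

/-- The fractional power `Q ^ α = (1 + Q) / 2 + e ^ (-iπα) (1 - Q) / 2` of a unitary `Q` with
eigenvalues `±1`: it is `1` on the eigenspace of `1` and `e ^ (-iπα)` on that of `-1`. -/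
def fractionalPower {d : ℕ} (Q : Matrix (Fin d) (Fin d) ℂ) (α : ℝ) : Matrix (Fin d) (Fin d) ℂ :=
  (1 / 2 : ℂ) • (1 + Q) + (Complex.exp (-Complex.I * Real.pi * α) / 2) • (1 - Q)

/-- One step of a fractional-query algorithm: a fractional query `Q_i ^ α` with `0 < α ≤ 1`,
followed by a unitary that does not depend on the oracles. -/
structure FractionalStep (η d : ℕ) where
  exponent : ℝ
  exponent_pos : 0 < exponent
  exponent_le_one : exponent ≤ 1
  oracle : Fin η
  gate : Matrix.unitaryGroup (Fin d) ℂ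

/-- A fractional-query algorithm `U_l Q_{i_l}^{α_l} U_{l-1} ⋯ U_1 Q_{i_1}^{α_1} U_0` over `η`
oracles on `ℂ^d`: the unitary `U_0` and the list of the steps `(α_k, i_k, U_k)`, `k = 1, …, l`,
in the order in which they are applied. -/
structure FractionalQueryAlgorithm (η d : ℕ) where
  first : Matrix.unitaryGroup (Fin d) ℂ
  steps : List (FractionalStep η d)

/-- The cost `α_1 + ⋯ + α_l`. -/
def FractionalQueryAlgorithm.cost {η d : ℕ} (A : FractionalQueryAlgorithm η d) : ℝ :=
  (A.steps.map FractionalStep.exponent).sum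

/-- The operation `U_l Q_{i_l}^{α_l} U_{l-1} ⋯ U_1 Q_{i_1}^{α_1} U_0` that the algorithm performs
when it is run with the oracles `Q_1, …, Q_η`. -/
def FractionalQueryAlgorithm.eval {η d : ℕ} (A : FractionalQueryAlgorithm η d)
    (Q : Fin η → Matrix (Fin d) (Fin d) ℂ) : Matrix (Fin d) (Fin d) ℂ :=
  A.steps.foldl (fun M s => s.gate.1 * fractionalPower (Q s.oracle) s.exponent * M) A.first.1

/-- The oracle `Q = ∑_j |j⟩⟨j| ⊗ Q_j` on `ℂ^η ⊗ ℂ^d`. -/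
def jointOracle {η d : ℕ} (Q : Fin η → Matrix (Fin d) (Fin d) ℂ) :
    Matrix (Fin η × Fin d) (Fin η × Fin d) ℂ :=
  ∑ j : Fin η, Matrix.single j j (1 : ℂ) ⊗ₖ Q j

/-- The computational basis of the space on which a query circuit acts: a work register, the
control qubit of the query gate, the index register, and the target system. -/
abbrev Register (Work : Type) (η d : ℕ) : Type := Work × (Fin 2 × (Fin η × Fin d))

/-- The query gate: one application of `Q = ∑_j |j⟩⟨j| ⊗ Q_j`, controlled by a qubit, that is
`|0⟩⟨0| ⊗ 1 + |1⟩⟨1| ⊗ Q`, with the identity on the work register. An uncontrolled query is the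
special case in which the control qubit is in the state `|1⟩`. -/
def queryGate (Work : Type) [Fintype Work] [DecidableEq Work] {η d : ℕ}
    (Q : Fin η → Matrix (Fin d) (Fin d) ℂ) :
    Matrix (Register Work η d) (Register Work η d) ℂ :=
  (1 : Matrix Work Work ℂ) ⊗ₖ
    (Matrix.single (0 : Fin 2) 0 (1 : ℂ) ⊗ₖ (1 : Matrix (Fin η × Fin d) (Fin η × Fin d) ℂ) +
      Matrix.single (1 : Fin 2) 1 (1 : ℂ) ⊗ₖ jointOracle Q)

/-- A discrete-query circuit `W_k Q W_{k-1} ⋯ W_1 Q W_0`: a finite work register, the computational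
basis state in which the work, control and index registers start, the unitary `W_0`, and the list
`W_1, …, W_k`. None of these data may depend on the oracles. -/
structure QueryCircuit (η d : ℕ) where
  Work : Type
  [fintypeWork : Fintype Work]
  [decidableEqWork : DecidableEq Work]
  initWork : Work
  initControl : Fin 2
  initIndex : Fin η
  first : Matrix.unitaryGroup (Register Work η d) ℂ
  rest : List (Matrix.unitaryGroup (Register Work η d) ℂ)

attribute [instance] QueryCircuit.fintypeWork QueryCircuit.decidableEqWork

/-- The number of queries that the circuit makes. -/
def QueryCircuit.queries {η d : ℕ} (C : QueryCircuit η d) : ℕ := C.rest.length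

/-- The operation `W_k Q W_{k-1} ⋯ W_1 Q W_0` that the circuit performs, where `Q` is the query
gate for the oracles `Q_1, …, Q_η`. -/
def QueryCircuit.eval {η d : ℕ} (C : QueryCircuit η d)
    (Q : Fin η → Matrix (Fin d) (Fin d) ℂ) :
    Matrix (Register C.Work η d) (Register C.Work η d) ℂ :=
  C.rest.foldl (fun M W => W.1 * queryGate C.Work Q * M) C.first.1

/-- The state `|init⟩ ⊗ ψ`: all registers but the target system are in their initial basis
state. -/
def QueryCircuit.embed {η d : ℕ} (C : QueryCircuit η d) (ψ : Fin d → ℂ) :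
    Register C.Work η d → ℂ :=
  fun x => if x.1 = C.initWork ∧ x.2.1 = C.initControl ∧ x.2.2.1 = C.initIndex
    then ψ x.2.2.2 else 0

/-- Run with the oracles `Q`, the circuit implements `U` with error at most `ε`: for every unit
vector `ψ`, it maps `|init⟩ ⊗ ψ` to a state within Euclidean distance `ε` of `|init⟩ ⊗ U ψ`. -/
def QueryCircuit.Implements {η d : ℕ} (C : QueryCircuit η d)
    (Q : Fin η → Matrix (Fin d) (Fin d) ℂ) (U : Matrix (Fin d) (Fin d) ℂ) (ε : ℝ) : Prop :=
  ∀ ψ : Fin d → ℂ, ‖WithLp.toLp 2 ψ‖ = 1 →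
    ‖WithLp.toLp 2 ((C.eval Q).mulVec (C.embed ψ) - C.embed (U.mulVec ψ))‖ ≤ ε

end

open Filter
open scoped Matrix Matrix.Norms.L2Operator Pointwise

/-!
Each fractional query is a combination of `1` and `Q_j` in which `Q_j` has a coefficient of modulus
at most `πα / 2`. Multiply out a piece of the algorithm of cost at most `1 / 4` and drop the
products that contain `k` oracles or more: the error is at most `1 / k!`, and the moduli of the
coefficients add up to at most `e ^ (π / 8) ≤ 2`. By the linear combination of unitaries
construction, half of such a combination is a block of a circuit with `k` queries, and one round of
oblivious amplitude amplification removes the factor `1 / 2` at the price of tripling the queries.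
The algorithm is the composition of at most `⌈4T⌉` such pieces, and errors add up, so that it
suffices to have `20 T / ε ≤ k!`, which holds for some `k = O(log (T / ε) / log log (T / ε))`.
-/

/-! ### Families of operators computed with a given number of queries -/

/-- `QueryComputable q k F`: the family of matrices `F` is computed by a circuit that uses the query
gates `q` exactly `k` times, with interspersed unitaries that do not depend on the parameter. -/
inductive QueryComputable {ι n : Type*} [Fintype n] [DecidableEq n] (q : ι → Matrix n n ℂ) :
    ℕ → (ι → Matrix n n ℂ) → Prop
  | const (U : Matrix.unitaryGroup n ℂ) : QueryComputable q 0 (fun _ => U.1)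
  | step {k : ℕ} {F : ι → Matrix n n ℂ} (U : Matrix.unitaryGroup n ℂ)
      (hF : QueryComputable q k F) : QueryComputable q (k + 1) (fun x => U.1 * q x * F x)

namespace QueryComputable

variable {ι n : Type*} [Fintype n] [DecidableEq n] {q : ι → Matrix n n ℂ} {k l : ℕ}
  {F G : ι → Matrix n n ℂ}

theorem const_mul (U : Matrix.unitaryGroup n ℂ) (hF : QueryComputable q k F) :
    QueryComputable q k (fun x => U.1 * F x) := by
  cases hF with
  | const V => exact const (U * V)
  | step V hF => simpa [Matrix.mul_assoc] using step (U * V) hF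

theorem mul (hF : QueryComputable q k F) (hG : QueryComputable q l G) :
    QueryComputable q (k + l) (fun x => F x * G x) := by
  induction hF with
  | const U => simpa using hG.const_mul U
  | step U _ ih => simpa [Matrix.mul_assoc, add_right_comm] using step U ih

theorem mul_const (U : Matrix.unitaryGroup n ℂ) (hF : QueryComputable q k F) :
    QueryComputable q k (fun x => F x * U.1) :=
  hF.mul (const U)

theorem query : QueryComputable q 1 q := by
  simpa using step 1 (const (q := q) 1)

theorem conjTranspose (hq : ∀ x, (q x)ᴴ = q x) (hF : QueryComputable q k F) :
    QueryComputable q k (fun x => (F x)ᴴ) := by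
  induction hF with
  | const U => exact const (star U)
  | step U _ ih =>
    simpa [Matrix.mul_assoc, hq, Matrix.star_eq_conjTranspose] using
      (ih.mul query).mul_const (star U)

theorem mem_unitaryGroup (hq : ∀ x, q x ∈ Matrix.unitaryGroup n ℂ) (hF : QueryComputable q k F)
    (x : ι) : F x ∈ Matrix.unitaryGroup n ℂ := by
  induction hF with
  | const U => exact U.2
  | step U _ ih => exact mul_mem (mul_mem U.2 (hq x)) ih

theorem eq_const (hF : QueryComputable q 0 F) :
    ∃ U : Matrix.unitaryGroup n ℂ, F = fun _ => U.1 := by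
  cases hF with
  | const U => exact ⟨U, rfl⟩

theorem eq_step (hF : QueryComputable q (k + 1) F) :
    ∃ (U : Matrix.unitaryGroup n ℂ) (G : ι → Matrix n n ℂ),
      QueryComputable q k G ∧ F = fun x => U.1 * q x * G x := by
  cases hF with
  | step U hG => exact ⟨U, _, hG, rfl⟩

theorem exists_list (hF : QueryComputable q k F) :
    ∃ (U : Matrix.unitaryGroup n ℂ) (l : List (Matrix.unitaryGroup n ℂ)), l.length = k ∧
      ∀ x, l.foldl (fun M W => W.1 * q x * M) U.1 = F x := by
  induction hF with
  | const U => exact ⟨U, [], rfl, fun _ => rfl⟩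
  | step U _ ih =>
    obtain ⟨V, l, hl, h⟩ := ih
    exact ⟨V, l ++ [U], by simp [hl], fun x => by simp [h]⟩

end QueryComputable

/-! ### Controlled gates and ancilla states -/

section Select

variable {ι J n : Type*} [Fintype J] [DecidableEq J]

/-- The gate `∑ j, |j⟩⟨j| ⊗ F j`, which applies the operator selected by the first register. -/
noncomputable def selectGate (F : J → Matrix n n ℂ) : Matrix (J × n) (J × n) ℂ :=
  ∑ j, Matrix.single j j (1 : ℂ) ⊗ₖ F j

theorem selectGate_apply (F : J → Matrix n n ℂ) (x y : J × n) :
    selectGate F x y = if x.1 = y.1 then F x.1 x.2 y.2 else 0 := by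
  simp [selectGate, Matrix.sum_apply, Matrix.single_apply, ite_and]

theorem selectGate_const (A : Matrix n n ℂ) :
    selectGate (fun _ : J => A) = 1 ⊗ₖ A := by
  ext x y
  simp [selectGate_apply, Matrix.one_apply]

theorem selectGate_conjTranspose (F : J → Matrix n n ℂ) :
    (selectGate F)ᴴ = selectGate fun j => (F j)ᴴ := by
  simp [selectGate, Matrix.conjTranspose_sum, Matrix.conjTranspose_kronecker]

variable [Fintype n]

theorem selectGate_mul_selectGate (F G : J → Matrix n n ℂ) :
    selectGate F * selectGate G = selectGate fun j => F j * G j := by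
  ext x y
  by_cases h : x.1 = y.1 <;>
    simp [Matrix.mul_apply, Fintype.sum_prod_type, selectGate_apply, Finset.sum_ite_irrel, h]

variable [DecidableEq n]

theorem selectGate_mem_unitaryGroup {F : J → Matrix n n ℂ}
    (hF : ∀ j, F j ∈ Matrix.unitaryGroup n ℂ) :
    selectGate F ∈ Matrix.unitaryGroup (J × n) ℂ := by
  simp only [Matrix.mem_unitaryGroup_iff, Matrix.star_eq_conjTranspose] at hF ⊢
  simp only [selectGate_conjTranspose, selectGate_mul_selectGate, hF, selectGate_const,
    Matrix.one_kronecker_one]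

theorem QueryComputable.select {q : ι → Matrix n n ℂ} {k : ℕ} {F : J → ι → Matrix n n ℂ}
    (hF : ∀ j, QueryComputable q k (F j)) :
    QueryComputable (fun x => (1 : Matrix J J ℂ) ⊗ₖ q x) k
      (fun x => selectGate fun j => F j x) := by
  induction k generalizing F with
  | zero =>
    choose U hU using fun j => (hF j).eq_const
    simpa only [hU] using QueryComputable.const (q := fun x => (1 : Matrix J J ℂ) ⊗ₖ q x)
      ⟨_, selectGate_mem_unitaryGroup fun j => (U j).2⟩
  | succ k ih =>
    choose U G hG hU using fun j => (hF j).eq_step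
    simpa only [hU, ← selectGate_const, selectGate_mul_selectGate] using
      QueryComputable.step ⟨_, selectGate_mem_unitaryGroup fun j => (U j).2⟩ (ih hG)

end Select

section KetTensor

variable {J n m : Type*}

/-- The operator `|r⟩ ⊗ e`, which applies `e` and adjoins a register in the state `r`. -/
def ketTensor (r : J → ℂ) (e : Matrix n m ℂ) : Matrix (J × n) m ℂ :=
  Matrix.of fun x y => r x.1 * e x.2 y

theorem ketTensor_mul [Fintype m] (r : J → ℂ) (e : Matrix n m ℂ) (A : Matrix m m ℂ) :
    ketTensor r (e * A) = ketTensor r e * A := by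
  ext x y
  simp [ketTensor, Matrix.mul_apply, Finset.mul_sum, mul_assoc]

variable [Fintype J] [Fintype n]

theorem kronecker_mul_ketTensor (A : Matrix J J ℂ) (B : Matrix n n ℂ) (r : J → ℂ)
    (e : Matrix n m ℂ) : (A ⊗ₖ B) * ketTensor r e = ketTensor (A *ᵥ r) (B * e) := by
  ext x y
  simp only [ketTensor, Matrix.mul_apply, Matrix.kroneckerMap_apply, Matrix.of_apply,
    Matrix.mulVec, dotProduct, Fintype.sum_prod_type, Finset.sum_mul_sum]
  exact Finset.sum_congr rfl fun i _ => Finset.sum_congr rfl fun j _ => by ring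

theorem ketTensor_conjTranspose_mul_ketTensor (r s : J → ℂ) (e f : Matrix n m ℂ) :
    (ketTensor r e)ᴴ * ketTensor s f = (star r ⬝ᵥ s) • (eᴴ * f) := by
  ext x y
  simp only [ketTensor, Matrix.mul_apply, Matrix.conjTranspose_apply, Matrix.of_apply, star_mul',
    Matrix.smul_apply, smul_eq_mul, dotProduct, Pi.star_apply, Fintype.sum_prod_type,
    Finset.sum_mul_sum]
  exact Finset.sum_congr rfl fun i _ => Finset.sum_congr rfl fun j _ => by ring

variable [DecidableEq J]

theorem ketTensor_single_isometry [DecidableEq m] {e : Matrix n m ℂ} (he : eᴴ * e = 1) (j : J) :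
    (ketTensor (Pi.single j 1) e)ᴴ * ketTensor (Pi.single j 1) e = 1 := by
  simp [ketTensor_conjTranspose_mul_ketTensor, he]

theorem selectGate_mul_ketTensor_single (F : J → Matrix n n ℂ) (j : J) (e : Matrix n m ℂ) :
    selectGate F * ketTensor (Pi.single j 1) e = ketTensor (Pi.single j 1) (F j * e) := by
  ext x y
  by_cases h : x.1 = j <;>
    simp [selectGate_apply, ketTensor, Matrix.mul_apply, Fintype.sum_prod_type, Pi.single_apply, h]

theorem ketTensor_conjTranspose_mul_selectGate_mul_ketTensor (r : J → ℂ) (e : Matrix n m ℂ)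
    (F : J → Matrix n n ℂ) :
    (ketTensor r e)ᴴ * (selectGate F * ketTensor r e) =
      ∑ j, (star (r j) * r j) • (eᴴ * (F j * e)) := by
  simp only [selectGate, Matrix.sum_mul, Matrix.mul_sum, kronecker_mul_ketTensor,
    ketTensor_conjTranspose_mul_ketTensor, Matrix.single_mulVec, one_mul]
  exact Finset.sum_congr rfl fun j _ => congrArg (· • _) (dotProduct_single (star r) (r j) j)

theorem exists_unitary_mulVec_single (j₀ : J) {r : J → ℂ} (hr : ∑ j, ‖r j‖ ^ 2 = 1) :
    ∃ U : Matrix.unitaryGroup J ℂ, U.1 *ᵥ Pi.single j₀ 1 = r := by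
  have hn : ‖(WithLp.toLp 2 r : EuclideanSpace ℂ J)‖ = 1 := by
    rw [EuclideanSpace.norm_eq, hr, Real.sqrt_one]
  have ho : Orthonormal ℂ (({j₀} : Set J).domRestrict
      fun _ : J => (WithLp.toLp 2 r : EuclideanSpace ℂ J)) :=
    ⟨fun _ => hn, fun i j hij => (hij (Subsingleton.elim i j)).elim⟩
  obtain ⟨b, hb⟩ := ho.exists_orthonormalBasis_extension_of_card_eq (by simp)
  refine ⟨⟨_, (EuclideanSpace.basisFun J ℂ).toMatrix_orthonormalBasis_mem_unitary b⟩, ?_⟩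
  ext j
  simp [Module.Basis.toMatrix_apply, hb j₀ rfl]

end KetTensor

/-! ### Convex combinations of circuits -/

theorem balanced_convexHull {E : Type*} [AddCommGroup E] [Module ℂ E] {S : Set E}
    (hS : ∀ z : ℂ, ‖z‖ = 1 → ∀ x ∈ S, z • x ∈ S) : Balanced ℂ (convexHull ℝ S) := by
  have unit_smul : ∀ z : ℂ, ‖z‖ = 1 → ∀ x ∈ convexHull ℝ S, z • x ∈ convexHull ℝ S := by
    intro z hz x hx
    have h := Set.mem_image_of_mem (LinearMap.lsmul ℂ E z |>.restrictScalars ℝ) hx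
    rw [LinearMap.image_convexHull] at h
    exact convexHull_mono (Set.image_subset_iff.2 (hS z hz)) h
  rw [balanced_iff_smul_mem]
  intro a ha x hx
  have neg_mem : -x ∈ convexHull ℝ S := by simpa using unit_smul (-1) (by simp) x hx
  have zero_mem : (0 : E) ∈ convexHull ℝ S := by
    have h := convex_convexHull ℝ S hx neg_mem one_half_pos.le one_half_pos.le (add_halves 1)
    rwa [smul_neg, add_neg_cancel] at h
  have polar : a • x = ‖a‖ • Complex.exp (a.arg * Complex.I) • x := by
    rw [← Complex.coe_smul, smul_smul, Complex.norm_mul_exp_arg_mul_I]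
  rw [polar]
  exact (convex_convexHull ℝ S).smul_mem_of_zero_mem zero_mem
    (unit_smul _ (Complex.norm_exp_ofReal_mul_I _) x hx) ⟨norm_nonneg a, ha⟩

theorem smul_mem_norm_mul_smul_of_balanced {E : Type*} [AddCommGroup E] [Module ℂ E] {H : Set E}
    (hH : Balanced ℂ H) {s : ℝ} {x : E} (hx : x ∈ s • H) (z : ℂ) : z • x ∈ (‖z‖ * s) • H := by
  obtain ⟨y, hy, rfl⟩ := hx
  rw [smul_comm, mul_comm, mul_smul]
  exact Set.smul_mem_smul_set (hH.smul_mono (b := ‖z‖) (by simp) (Set.smul_mem_smul_set hy))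

theorem smul_set_mono_of_balanced {E : Type*} [AddCommGroup E] [Module ℂ E] {H : Set E}
    (hH : Balanced ℂ H) {s t : ℝ} (hst : |s| ≤ |t|) : s • H ⊆ t • H := by
  rintro _ ⟨x, hx, rfl⟩
  exact hH.smul_mono (a := (s : ℂ)) (by simpa using hst) ⟨x, hx, Complex.coe_smul s x⟩

/-- The families of operators `V` that are performed exactly, on the subsystem embedded by `e`, by a
circuit with `k` queries. -/
def exactlyComputable {ι n m : Type*} [Fintype n] [DecidableEq n] [Fintype m]
    (q : ι → Matrix n n ℂ) (e : Matrix n m ℂ) (k : ℕ) : Set (ι → Matrix m m ℂ) :=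
  {V | ∃ F, QueryComputable q k F ∧ ∀ x, F x * e = e * V x}

section ExactlyComputable

variable {ι n m : Type*} [Fintype n] [DecidableEq n] [Fintype m] {q : ι → Matrix n n ℂ}
  {e : Matrix n m ℂ} {k l : ℕ} {V W : ι → Matrix m m ℂ}

theorem mul_mem_exactlyComputable (hV : V ∈ exactlyComputable q e k)
    (hW : W ∈ exactlyComputable q e l) : V * W ∈ exactlyComputable q e (k + l) := by
  obtain ⟨F, hF, hFe⟩ := hV
  obtain ⟨G, hG, hGe⟩ := hW
  refine ⟨_, hF.mul hG, fun x => ?_⟩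
  rw [Matrix.mul_assoc, hGe, ← Matrix.mul_assoc, hFe, Matrix.mul_assoc, Pi.mul_apply]

theorem smul_mem_exactlyComputable {z : ℂ} (hz : ‖z‖ = 1) (hV : V ∈ exactlyComputable q e k) :
    z • V ∈ exactlyComputable q e k := by
  obtain ⟨F, hF, hFe⟩ := hV
  have hz1 : z • (1 : Matrix n n ℂ) ∈ Matrix.unitaryGroup n ℂ :=
    Unitary.smul_mem_of_mem (by simp [Unitary.mem_iff, Complex.conj_mul', Complex.mul_conj', hz])
      (one_mem _)
  exact ⟨_, hF.const_mul ⟨_, hz1⟩, fun x => by simp [hFe]⟩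

theorem const_mem_exactlyComputable {P : Matrix n n ℂ} (hP : P ∈ Matrix.unitaryGroup n ℂ)
    {U : Matrix m m ℂ} (h : P * e = e * U) : (fun _ => U) ∈ exactlyComputable q e 0 :=
  ⟨_, .const ⟨P, hP⟩, fun _ => h⟩

theorem one_mem_exactlyComputable [DecidableEq m] (hqe : ∀ x, q x * e = e) (k : ℕ) :
    1 ∈ exactlyComputable q e k := by
  induction k with
  | zero => exact ⟨_, .const 1, fun x => by simp⟩
  | succ k ih => simpa using mul_mem_exactlyComputable ih ⟨q, .query, fun x => by simp [hqe]⟩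

theorem balanced_convexHull_exactlyComputable :
    Balanced ℂ (convexHull ℝ (exactlyComputable q e k)) :=
  balanced_convexHull fun _ hz _ hV => smul_mem_exactlyComputable hz hV

theorem smul_mul_mem_smul_convexHull_exactlyComputable (hV : V ∈ exactlyComputable q e k) {t : ℝ}
    (hW : W ∈ t • convexHull ℝ (exactlyComputable q e l)) (z : ℂ) :
    (z • V) * W ∈ (‖z‖ * t) • convexHull ℝ (exactlyComputable q e (k + l)) := by
  obtain ⟨G, hG, rfl⟩ := hW
  have h := Set.mem_image_of_mem (LinearMap.mulLeft ℝ V) hG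
  rw [LinearMap.image_convexHull] at h
  have image_subset :
      LinearMap.mulLeft ℝ V '' exactlyComputable q e l ⊆ exactlyComputable q e (k + l) :=
    Set.image_subset_iff.2 fun W hW => mul_mem_exactlyComputable hV hW
  have hVG : V * G ∈ convexHull ℝ (exactlyComputable q e (k + l)) := convexHull_mono image_subset h
  have hVtG : V * t • G ∈ t • convexHull ℝ (exactlyComputable q e (k + l)) :=
    ⟨V * G, hVG, (mul_smul_comm t V G).symm⟩
  rw [smul_mul_assoc]
  exact smul_mem_norm_mul_smul_of_balanced balanced_convexHull_exactlyComputable hVtG z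

end ExactlyComputable

/-! ### Block encodings and amplitude amplification -/

/-- The family `G` is block-encodable with `k` queries if it is the block, on the subspace embedded
by `E`, of a unitary family computed with `k` queries. -/
def IsBlockEncodable {ι n m : Type*} [Fintype n] [DecidableEq n] (q : ι → Matrix n n ℂ)
    (E : Matrix n m ℂ) (k : ℕ) (G : ι → Matrix m m ℂ) : Prop :=
  ∃ W, QueryComputable q k W ∧ ∀ x, Eᴴ * (W x * E) = G x

section LinearCombination

variable {ι n m : Type*} [Fintype n] [DecidableEq n] [Fintype m] [DecidableEq m]
  {q : ι → Matrix n n ℂ} {e : Matrix n m ℂ} {k : ℕ}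

theorem isBlockEncodable_sum_smul {J : Type*} [Fintype J] [DecidableEq J] (he : eᴴ * e = 1)
    (j₀ : J) {w : J → ℝ} (hw : ∀ j, 0 ≤ w j) (hw_sum : ∑ j, w j = 1) {V : J → ι → Matrix m m ℂ}
    (hV : ∀ j, V j ∈ exactlyComputable q e k) :
    IsBlockEncodable (fun x => (1 : Matrix J J ℂ) ⊗ₖ q x) (ketTensor (Pi.single j₀ 1) e) k
      (∑ j, w j • V j) := by
  choose F hF hFe using hV
  set r : J → ℂ := fun j => (√(w j) : ℂ)
  have star_mul_r : ∀ j, star (r j) * r j = (w j : ℂ) := fun j => by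
    simp only [r, Complex.star_def, Complex.conj_ofReal]
    rw [← Complex.ofReal_mul, Real.mul_self_sqrt (hw j)]
  obtain ⟨U, hU⟩ := exists_unitary_mulVec_single j₀ (r := r) (by simp [r, Real.sq_sqrt, hw, hw_sum])
  let P : Matrix.unitaryGroup (J × n) ℂ := ⟨U.1 ⊗ₖ 1, Matrix.kronecker_mem_unitary U.2 (one_mem _)⟩
  have hP : P.1 * ketTensor (Pi.single j₀ 1) e = ketTensor r e := by
    rw [kronecker_mul_ketTensor, hU, Matrix.one_mul]
  refine ⟨_, ((QueryComputable.select hF).mul_const P).const_mul (star P), fun x => ?_⟩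
  calc (ketTensor (Pi.single j₀ 1) e)ᴴ *
        (P.1ᴴ * (selectGate (fun j => F j x) * P.1) * ketTensor (Pi.single j₀ 1) e)
      = (ketTensor r e)ᴴ * (selectGate (fun j => F j x) * ketTensor r e) := by
        simp only [← hP, Matrix.conjTranspose_mul, Matrix.mul_assoc]
    _ = (∑ j, w j • V j) x := by
        rw [ketTensor_conjTranspose_mul_selectGate_mul_ketTensor]
        simp only [star_mul_r, hFe, ← Matrix.mul_assoc, he, Matrix.one_mul, Complex.coe_smul,
          Finset.sum_apply, Pi.smul_apply]

theorem eventually_exists_fin_of_mem_convexHull {E : Type*} [AddCommGroup E] [Module ℝ E]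
    {S : Set E} {x : E} (hx : x ∈ convexHull ℝ S) :
    ∀ᶠ N : ℕ in atTop, ∃ (w : Fin (N + 1) → ℝ) (z : Fin (N + 1) → E), (∀ i, 0 ≤ w i) ∧
      ∑ i, w i = 1 ∧ (∀ i, z i ∈ S) ∧ ∑ i, w i • z i = x := by
  obtain ⟨y, hy⟩ := convexHull_nonempty_iff.1 ⟨x, hx⟩
  obtain ⟨J, _, w, z, hw, hw_sum, hz, rfl⟩ := mem_convexHull_iff_exists_fintype.1 hx
  filter_upwards [eventually_ge_atTop (Fintype.card J)] with N hN
  obtain ⟨f⟩ := Function.Embedding.nonempty_of_card_le (α := J) (β := Fin (N + 1))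
    (by simpa using hN.trans N.le_succ)
  have hw' : ∀ i ∉ Set.range f, Function.extend f w 0 i = 0 := fun i hi =>
    Function.extend_apply' w (0 : Fin (N + 1) → ℝ) i hi
  refine ⟨Function.extend f w 0, Function.extend f z fun _ => y, fun i => ?_, ?_, fun i => ?_, ?_⟩
  · by_cases hi : i ∈ Set.range f
    · obtain ⟨j, rfl⟩ := hi
      simpa [f.injective.extend_apply] using hw j
    · exact (hw' i hi).ge
  · rw [← hw_sum]
    exact (Fintype.sum_of_injective f f.injective _ _ hw' fun j => by
      rw [f.injective.extend_apply]).symm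
  · by_cases hi : i ∈ Set.range f
    · obtain ⟨j, rfl⟩ := hi
      simpa [f.injective.extend_apply] using hz j
    · rwa [Function.extend_apply' _ _ _ hi]
  · exact (Fintype.sum_of_injective f f.injective _ _ (fun i hi => by rw [hw' i hi, zero_smul])
      fun j => by simp only [f.injective.extend_apply]).symm

theorem eventually_isBlockEncodable (he : eᴴ * e = 1) {G : ι → Matrix m m ℂ}
    (hG : G ∈ convexHull ℝ (exactlyComputable q e k)) :
    ∀ᶠ N : ℕ in atTop, IsBlockEncodable (fun x => (1 : Matrix (Fin (N + 1)) _ ℂ) ⊗ₖ q x)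
      (ketTensor (Pi.single 0 1) e) k G := by
  filter_upwards [eventually_exists_fin_of_mem_convexHull hG] with N h
  obtain ⟨w, V, hw, hw_sum, hV, rfl⟩ := h
  exact isBlockEncodable_sum_smul he 0 hw hw_sum hV

end LinearCombination

section Isometry

variable {n m : Type*} [Fintype n] [Fintype m] [DecidableEq m]

theorem l2_opNorm_le_one_of_isometry {E : Matrix n m ℂ} (hE : Eᴴ * E = 1) : ‖E‖ ≤ 1 := by
  have h := Matrix.l2_opNorm_conjTranspose_mul_self E
  have h_one : ‖(1 : Matrix m m ℂ)‖ ≤ 1 := (IsStarProjection.one _).norm_le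
  rw [hE] at h
  nlinarith [norm_nonneg E]

theorem l2_opNorm_isometry_mul_le {E : Matrix n m ℂ} (hE : Eᴴ * E = 1) (A : Matrix m m ℂ) :
    ‖E * A‖ ≤ ‖A‖ :=
  (Matrix.l2_opNorm_mul E A).trans
    (mul_le_of_le_one_left (norm_nonneg A) (l2_opNorm_le_one_of_isometry hE))

theorem l2_opNorm_le_one_of_mem_unitaryGroup {U : Matrix m m ℂ}
    (hU : U ∈ Matrix.unitaryGroup m ℂ) : ‖U‖ ≤ 1 :=
  l2_opNorm_le_one_of_isometry (Matrix.mem_unitaryGroup_iff'.1 hU)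

end Isometry

section Amplification

variable {n m : Type*} [Fintype n] [DecidableEq n] [Fintype m]

/-- The reflection `1 - 2 E Eᴴ` about the orthogonal complement of the range of an isometry `E`. -/
def rangeReflection (E : Matrix n m ℂ) : Matrix n n ℂ := 1 - (2 : ℂ) • (E * Eᴴ)

theorem rangeReflection_mul (E : Matrix n m ℂ) (A : Matrix n m ℂ) :
    rangeReflection E * A = A - (2 : ℂ) • (E * (Eᴴ * A)) := by
  simp [rangeReflection, Matrix.sub_mul, Matrix.mul_assoc]

variable [DecidableEq m]

theorem rangeReflection_mem_unitaryGroup {E : Matrix n m ℂ} (hE : Eᴴ * E = 1) :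
    rangeReflection E ∈ Matrix.unitaryGroup n ℂ := by
  have hproj : E * Eᴴ * (E * Eᴴ) = E * Eᴴ := by
    rw [Matrix.mul_assoc, ← Matrix.mul_assoc Eᴴ, hE, Matrix.one_mul]
  have hself : (rangeReflection E)ᴴ = rangeReflection E := by simp [rangeReflection]
  rw [Matrix.mem_unitaryGroup_iff, Matrix.star_eq_conjTranspose, hself, rangeReflection]
  simp only [Matrix.sub_mul, Matrix.mul_sub, Matrix.one_mul, Matrix.mul_one, Matrix.smul_mul,
    Matrix.mul_smul, hproj]
  module

/-- One round of oblivious amplitude amplification of the unitary `W`, with respect to the range of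
the isometry `E`. -/
def amplify (E : Matrix n m ℂ) (W : Matrix n n ℂ) : Matrix n n ℂ :=
  -(W * rangeReflection E * Wᴴ * rangeReflection E * W)

variable {E : Matrix n m ℂ} {W : Matrix n n ℂ} {S V : Matrix m m ℂ} {δ : ℝ}

theorem amplify_mul_isometry (hE : Eᴴ * E = 1) (hW : W ∈ Matrix.unitaryGroup n ℂ)
    (hS : Eᴴ * (W * E) = (1 / 2 : ℂ) • S) :
    amplify E W * E = E * S + W * (E * (1 - Sᴴ * S)) := by
  have hS' : Eᴴ * (Wᴴ * E) = (1 / 2 : ℂ) • Sᴴ := by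
    simpa [Matrix.conjTranspose_mul, Matrix.mul_assoc] using congrArg Matrix.conjTranspose hS
  have hWW : Wᴴ * W = 1 := Matrix.mem_unitaryGroup_iff'.1 hW
  have hWW' : W * Wᴴ = 1 := Matrix.mem_unitaryGroup_iff.1 hW
  have first_reflection : rangeReflection E * (W * E) = W * E - E * S := by
    rw [rangeReflection_mul, hS, Matrix.mul_smul]
    module
  have undo : Wᴴ * (W * E - E * S) = E - Wᴴ * E * S := by
    rw [Matrix.mul_sub, ← Matrix.mul_assoc, hWW, Matrix.one_mul, Matrix.mul_assoc]
  have second_reflection :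
      rangeReflection E * (E - Wᴴ * E * S) = -(E * (1 - Sᴴ * S)) - Wᴴ * E * S := by
    rw [rangeReflection_mul, Matrix.mul_sub, hE, ← Matrix.mul_assoc Eᴴ, hS']
    simp only [Matrix.mul_sub, Matrix.smul_mul, Matrix.mul_smul, Matrix.mul_one]
    module
  calc amplify E W * E
      = -(W * (rangeReflection E * (Wᴴ * (rangeReflection E * (W * E))))) := by
        simp only [amplify, Matrix.neg_mul, Matrix.mul_assoc]
    _ = -(W * (-(E * (1 - Sᴴ * S)) - Wᴴ * E * S)) := by
        rw [first_reflection, undo, second_reflection]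
    _ = E * S + W * (E * (1 - Sᴴ * S)) := by
        rw [Matrix.mul_sub, Matrix.mul_assoc Wᴴ, ← Matrix.mul_assoc W Wᴴ, hWW', Matrix.one_mul,
          Matrix.mul_neg]
        abel

theorem l2_opNorm_one_sub_conjTranspose_mul_self_le (hV : V ∈ Matrix.unitaryGroup m ℂ)
    (hδ : δ ≤ 1) (hVS : ‖V - S‖ ≤ δ) : ‖1 - Sᴴ * S‖ ≤ 3 * δ := by
  have hVV : Vᴴ * V = 1 := Matrix.mem_unitaryGroup_iff'.1 hV
  have hV_norm : ‖V‖ ≤ 1 := l2_opNorm_le_one_of_mem_unitaryGroup hV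
  have hS_norm : ‖Sᴴ‖ ≤ 2 := by
    rw [Matrix.l2_opNorm_conjTranspose]
    linarith [norm_le_norm_add_norm_sub V S]
  calc ‖1 - Sᴴ * S‖ = ‖(V - S)ᴴ * V + Sᴴ * (V - S)‖ := by
        rw [Matrix.conjTranspose_sub, Matrix.sub_mul, hVV, Matrix.mul_sub]
        abel_nf
    _ ≤ ‖(V - S)ᴴ * V‖ + ‖Sᴴ * (V - S)‖ := norm_add_le _ _
    _ ≤ δ + 2 * δ := by
        refine add_le_add ?_ ((Matrix.l2_opNorm_mul _ _).trans ?_)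
        · rwa [CStarRing.norm_mul_mem_unitary _ hV, Matrix.l2_opNorm_conjTranspose]
        · exact mul_le_mul hS_norm hVS (norm_nonneg _) zero_le_two
    _ = 3 * δ := by ring

theorem norm_amplify_mul_sub_le (hE : Eᴴ * E = 1) (hW : W ∈ Matrix.unitaryGroup n ℂ)
    (hV : V ∈ Matrix.unitaryGroup m ℂ) (hS : Eᴴ * (W * E) = (1 / 2 : ℂ) • S) (hδ : δ ≤ 1)
    (hVS : ‖V - S‖ ≤ δ) : ‖amplify E W * E - E * V‖ ≤ 4 * δ := by
  have hW_norm : ‖W‖ ≤ 1 := l2_opNorm_le_one_of_mem_unitaryGroup hW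
  calc ‖amplify E W * E - E * V‖ = ‖W * (E * (1 - Sᴴ * S)) - E * (V - S)‖ := by
        rw [amplify_mul_isometry hE hW hS, Matrix.mul_sub E V]
        abel_nf
    _ ≤ ‖W * (E * (1 - Sᴴ * S))‖ + ‖E * (V - S)‖ := norm_sub_le _ _
    _ ≤ ‖1 - Sᴴ * S‖ + ‖V - S‖ := by
        refine add_le_add ?_ (l2_opNorm_isometry_mul_le hE _)
        exact (Matrix.l2_opNorm_mul _ _).trans
          ((mul_le_of_le_one_left (norm_nonneg _) hW_norm).trans (l2_opNorm_isometry_mul_le hE _))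
    _ ≤ 3 * δ + δ :=
        add_le_add (l2_opNorm_one_sub_conjTranspose_mul_self_le hV hδ hVS) hVS
    _ = 4 * δ := by ring

end Amplification

/-! ### Approximate simulation -/

/-- The family `V` is simulated, on the subsystem embedded by `E`, by a circuit with `k` queries up
to an error of `δ` in the operator norm. -/
def IsSimulable {ι n m : Type*} [Fintype n] [DecidableEq n] [Fintype m] [DecidableEq m]
    (q : ι → Matrix n n ℂ) (E : Matrix n m ℂ) (k : ℕ) (V : ι → Matrix m m ℂ) (δ : ℝ) : Prop :=
  ∃ F, QueryComputable q k F ∧ ∀ x, ‖F x * E - E * V x‖ ≤ δ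

section Simulation

variable {ι n m : Type*} [Fintype n] [DecidableEq n] [Fintype m] [DecidableEq m]
  {q : ι → Matrix n n ℂ} {E : Matrix n m ℂ} {k l : ℕ} {V V' : ι → Matrix m m ℂ} {δ δ' : ℝ}

theorem IsSimulable.of_mem_exactlyComputable (hV : V ∈ exactlyComputable q E k) :
    IsSimulable q E k V 0 := by
  obtain ⟨F, hF, h⟩ := hV
  exact ⟨F, hF, fun x => by simp [h]⟩

theorem IsSimulable.mul (hq : ∀ x, q x ∈ Matrix.unitaryGroup n ℂ) (hV : IsSimulable q E k V δ)
    (hV' : IsSimulable q E l V' δ') (hV'_unitary : ∀ x, V' x ∈ Matrix.unitaryGroup m ℂ) :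
    IsSimulable q E (k + l) (fun x => V x * V' x) (δ + δ') := by
  obtain ⟨F, hF, h⟩ := hV
  obtain ⟨F', hF', h'⟩ := hV'
  refine ⟨_, hF.mul hF', fun x => ?_⟩
  have hF_norm := l2_opNorm_le_one_of_mem_unitaryGroup (hF.mem_unitaryGroup hq x)
  have hV'_norm := l2_opNorm_le_one_of_mem_unitaryGroup (hV'_unitary x)
  calc ‖F x * F' x * E - E * (V x * V' x)‖
      = ‖(F x * E - E * V x) * V' x + F x * (F' x * E - E * V' x)‖ := by
        simp only [Matrix.sub_mul, Matrix.mul_sub, Matrix.mul_assoc, sub_add_sub_cancel']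
    _ ≤ ‖(F x * E - E * V x) * V' x‖ + ‖F x * (F' x * E - E * V' x)‖ := norm_add_le _ _
    _ ≤ ‖F x * E - E * V x‖ + ‖F' x * E - E * V' x‖ := by
        refine add_le_add ((Matrix.l2_opNorm_mul _ _).trans ?_)
          ((Matrix.l2_opNorm_mul _ _).trans ?_)
        · exact mul_le_of_le_one_right (norm_nonneg _) hV'_norm
        · exact mul_le_of_le_one_left (norm_nonneg _) hF_norm
    _ ≤ δ + δ' := add_le_add (h x) (h' x)

theorem IsBlockEncodable.isSimulable (hq : ∀ x, q x ∈ Matrix.unitaryGroup n ℂ)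
    (hq_self : ∀ x, (q x)ᴴ = q x) (hE : Eᴴ * E = 1) {S : ι → Matrix m m ℂ}
    (hS : IsBlockEncodable q E k ((1 / 2 : ℂ) • S)) (hV : ∀ x, V x ∈ Matrix.unitaryGroup m ℂ)
    (hδ : δ ≤ 1) (hVS : ∀ x, ‖V x - S x‖ ≤ δ) : IsSimulable q E (3 * k) V (4 * δ) := by
  obtain ⟨W, hW, hWS⟩ := hS
  let R : Matrix.unitaryGroup n ℂ := ⟨_, rangeReflection_mem_unitaryGroup hE⟩
  have hF : QueryComputable q (3 * k) fun x => amplify E (W x) := by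
    have h :=
      ((((hW.mul_const R).mul (hW.conjTranspose hq_self)).mul_const R).mul hW).const_mul (-1)
    convert h using 1
    · ring
    · simp [amplify, R, Unitary.coe_neg]
  exact ⟨_, hF, fun x => norm_amplify_mul_sub_le hE (hW.mem_unitaryGroup hq x) (hV x) (hWS x) hδ
    (hVS x)⟩

end Simulation

/-! ### The query gate -/

section Oracle

variable {η d : ℕ}

theorem IsSignOracle.conjTranspose_eq {Q : Matrix (Fin d) (Fin d) ℂ} (hQ : IsSignOracle Q) :
    Qᴴ = Q := by
  have hQ_normal : IsStarNormal Q :=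
    ⟨by rw [Commute, SemiconjBy, Matrix.mem_unitaryGroup_iff.1 hQ.1,
      Matrix.mem_unitaryGroup_iff'.1 hQ.1]⟩
  have star_eqOn : (spectrum ℂ Q).EqOn star id := fun x hx => by
    rcases hQ.2 hx with rfl | rfl <;> simp
  rw [← Matrix.star_eq_conjTranspose, ← cfc_star_id (R := ℂ) Q, cfc_congr star_eqOn, cfc_id ℂ Q]

theorem IsSignOracle.mul_self {Q : Matrix (Fin d) (Fin d) ℂ} (hQ : IsSignOracle Q) :
    Q * Q = 1 := by
  have h := Matrix.mem_unitaryGroup_iff.1 hQ.1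
  rwa [Matrix.star_eq_conjTranspose, hQ.conjTranspose_eq] at h

/-- The query gate on control, index and target, without the work register. -/
noncomputable def controlledOracle (Q : Fin η → Matrix (Fin d) (Fin d) ℂ) :
    Matrix (Fin 2 × (Fin η × Fin d)) (Fin 2 × (Fin η × Fin d)) ℂ :=
  selectGate ![1, selectGate Q]

theorem queryGate_eq_kronecker (Work : Type) [Fintype Work] [DecidableEq Work]
    (Q : Fin η → Matrix (Fin d) (Fin d) ℂ) : queryGate Work Q = 1 ⊗ₖ controlledOracle Q := by
  simp [queryGate, controlledOracle, selectGate, jointOracle]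

theorem controlledOracle_conjTranspose {Q : Fin η → Matrix (Fin d) (Fin d) ℂ}
    (hQ : ∀ j, IsSignOracle (Q j)) : (controlledOracle Q)ᴴ = controlledOracle Q := by
  rw [controlledOracle, selectGate_conjTranspose]
  congr 1
  ext1 c
  fin_cases c <;> simp [selectGate_conjTranspose, (hQ _).conjTranspose_eq]

theorem controlledOracle_mem_unitaryGroup {Q : Fin η → Matrix (Fin d) (Fin d) ℂ}
    (hQ : ∀ j, IsSignOracle (Q j)) :
    controlledOracle Q ∈ Matrix.unitaryGroup (Fin 2 × (Fin η × Fin d)) ℂ :=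
  selectGate_mem_unitaryGroup
    (Fin.forall_fin_two.2 ⟨one_mem _, selectGate_mem_unitaryGroup fun i => (hQ i).1⟩)

/-- The isometry `|c⟩|i⟩ ⊗ 1` from the target system to control, index and target. -/
def targetEmbedding (d : ℕ) (c : Fin 2) (i : Fin η) :
    Matrix (Fin 2 × (Fin η × Fin d)) (Fin d) ℂ :=
  ketTensor (Pi.single c 1) (ketTensor (Pi.single i 1) 1)

theorem targetEmbedding_conjTranspose_mul_self (c : Fin 2) (i : Fin η) :
    (targetEmbedding d c i)ᴴ * targetEmbedding d c i = 1 :=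
  ketTensor_single_isometry (ketTensor_single_isometry (by simp) i) c

theorem controlledOracle_mul_targetEmbedding_zero (Q : Fin η → Matrix (Fin d) (Fin d) ℂ)
    (i : Fin η) : controlledOracle Q * targetEmbedding d 0 i = targetEmbedding d 0 i := by
  rw [controlledOracle, targetEmbedding, selectGate_mul_ketTensor_single, Matrix.cons_val_zero,
    Matrix.one_mul]

theorem controlledOracle_mul_targetEmbedding_one (Q : Fin η → Matrix (Fin d) (Fin d) ℂ)
    (i : Fin η) : controlledOracle Q * targetEmbedding d 1 i = targetEmbedding d 1 i * Q i := by
  rw [controlledOracle, targetEmbedding, selectGate_mul_ketTensor_single, Matrix.cons_val_one,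
    Matrix.cons_val_zero, selectGate_mul_ketTensor_single, ← ketTensor_mul, ← ketTensor_mul,
    Matrix.mul_one, Matrix.one_mul]

theorem exists_unitary_mul_targetEmbedding (c c' : Fin 2) (i i' : Fin η) :
    ∃ P : Matrix.unitaryGroup (Fin 2 × (Fin η × Fin d)) ℂ,
      P.1 * targetEmbedding d c i = targetEmbedding d c' i' := by
  have sum_single {J : Type} [Fintype J] [DecidableEq J] (j : J) :
      ∑ j', ‖(Pi.single j 1 : J → ℂ) j'‖ ^ 2 = 1 := by
    simp [Pi.single_apply, apply_ite norm, ite_pow]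
  obtain ⟨A, hA⟩ := exists_unitary_mulVec_single c (sum_single c')
  obtain ⟨B, hB⟩ := exists_unitary_mulVec_single i (sum_single i')
  refine ⟨⟨A.1 ⊗ₖ (B.1 ⊗ₖ 1), Matrix.kronecker_mem_unitary A.2
    (Matrix.kronecker_mem_unitary B.2 (one_mem _))⟩, ?_⟩
  simp only [targetEmbedding, kronecker_mul_ketTensor, hA, hB, Matrix.one_mul]

/-- The oracle families of the model, which parametrize the computed families of operators. -/
abbrev OracleFamily (η d : ℕ) : Type :=
  {Q : Fin η → Matrix (Fin d) (Fin d) ℂ // ∀ j, IsSignOracle (Q j)}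

/-- The families of operators on the target system that circuits with `k` queries perform exactly,
when control and index start in the state `|0⟩|i₀⟩`. -/
abbrev targetComputable (d : ℕ) (i₀ : Fin η) (k : ℕ) :
    Set (OracleFamily η d → Matrix (Fin d) (Fin d) ℂ) :=
  exactlyComputable (fun Q => controlledOracle Q.1) (targetEmbedding d 0 i₀) k

theorem one_mem_targetComputable (i₀ : Fin η) (k : ℕ) : 1 ∈ targetComputable d i₀ k :=
  one_mem_exactlyComputable
    (fun Q : OracleFamily η d => controlledOracle_mul_targetEmbedding_zero Q.1 i₀) k

theorem oracle_mem_targetComputable (i₀ i : Fin η) :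
    (fun Q => Q.1 i) ∈ targetComputable d i₀ 1 := by
  obtain ⟨P, hP⟩ := exists_unitary_mul_targetEmbedding (d := d) 0 1 i₀ i
  have hP' : (star P).1 * targetEmbedding d 1 i = targetEmbedding d 0 i₀ := by
    rw [← hP, ← Matrix.mul_assoc, Unitary.coe_star, Unitary.coe_star_mul_self, Matrix.one_mul]
  refine ⟨_, (QueryComputable.query.mul_const P).const_mul (star P), fun Q => ?_⟩
  rw [Matrix.mul_assoc, Matrix.mul_assoc, hP, controlledOracle_mul_targetEmbedding_one,
    ← Matrix.mul_assoc, hP']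

theorem gate_mem_targetComputable (i₀ : Fin η) (U : Matrix.unitaryGroup (Fin d) ℂ) :
    (fun _ => U.1) ∈ targetComputable d i₀ 0 := by
  refine const_mem_exactlyComputable (P := 1 ⊗ₖ (1 ⊗ₖ U.1)) (Matrix.kronecker_mem_unitary
    (one_mem _) (Matrix.kronecker_mem_unitary (one_mem _) U.2)) ?_
  simp only [targetEmbedding, kronecker_mul_ketTensor, ← ketTensor_mul, Matrix.one_mulVec,
    Matrix.one_mul, Matrix.mul_one]

end Oracle

/-! ### Fractional powers -/

section FractionalPower

/-- The eigenvalue `e ^ (-iπα)` of the fractional power `Q ^ α` on the eigenspace of `-1`. -/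
noncomputable def fractionalPhase (α : ℝ) : ℂ := Complex.exp (-Complex.I * Real.pi * α)

theorem fractionalPhase_add (α β : ℝ) :
    fractionalPhase (α + β) = fractionalPhase α * fractionalPhase β := by
  rw [fractionalPhase, fractionalPhase, fractionalPhase, ← Complex.exp_add, Complex.ofReal_add,
    mul_add]

theorem norm_fractionalPhase (α : ℝ) : ‖fractionalPhase α‖ = 1 := by
  simp [fractionalPhase, Complex.norm_exp]

theorem star_fractionalPhase (α : ℝ) : star (fractionalPhase α) = fractionalPhase (-α) := by
  simp [fractionalPhase, ← Complex.exp_conj]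

theorem norm_one_add_fractionalPhase_le (α : ℝ) : ‖(1 + fractionalPhase α) / 2‖ ≤ 1 := by
  have h := norm_add_le (1 : ℂ) (fractionalPhase α)
  rw [norm_fractionalPhase, norm_one] at h
  rw [norm_div, Complex.norm_ofNat]
  linarith

theorem norm_one_sub_fractionalPhase_le {α : ℝ} (hα : 0 ≤ α) :
    ‖(1 - fractionalPhase α) / 2‖ ≤ Real.pi / 2 * α := by
  have h_eq : fractionalPhase α = Complex.exp (Complex.I * (-(Real.pi * α) : ℝ)) := by
    rw [fractionalPhase]
    push_cast
    ring_nf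
  have h := Real.norm_exp_I_mul_ofReal_sub_one_le (x := -(Real.pi * α))
  rw [← h_eq, norm_neg, Real.norm_of_nonneg (by positivity)] at h
  rw [norm_div, Complex.norm_ofNat, norm_sub_rev]
  linarith

variable {d : ℕ} {Q : Matrix (Fin d) (Fin d) ℂ}

theorem fractionalPower_eq (Q : Matrix (Fin d) (Fin d) ℂ) (α : ℝ) :
    fractionalPower Q α =
      ((1 + fractionalPhase α) / 2) • (1 : Matrix (Fin d) (Fin d) ℂ) +
        ((1 - fractionalPhase α) / 2) • Q := by
  rw [fractionalPower, fractionalPhase]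
  module

theorem fractionalPower_zero (Q : Matrix (Fin d) (Fin d) ℂ) : fractionalPower Q 0 = 1 := by
  simp [fractionalPower_eq, fractionalPhase]

theorem fractionalPower_mul (hQ : Q * Q = 1) (α β : ℝ) :
    fractionalPower Q α * fractionalPower Q β = fractionalPower Q (α + β) := by
  simp only [fractionalPower_eq, fractionalPhase_add, Matrix.add_mul, Matrix.mul_add,
    Matrix.smul_mul, Matrix.mul_smul, Matrix.one_mul, Matrix.mul_one, hQ]
  module

theorem fractionalPower_conjTranspose (hQ : Qᴴ = Q) (α : ℝ) :
    (fractionalPower Q α)ᴴ = fractionalPower Q (-α) := by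
  simp only [fractionalPower_eq, Matrix.conjTranspose_add, Matrix.conjTranspose_smul, hQ,
    Matrix.conjTranspose_one, star_div₀, star_add, star_sub, star_one, star_ofNat,
    star_fractionalPhase]

theorem fractionalPower_mem_unitaryGroup (hQ : IsSignOracle Q) (α : ℝ) :
    fractionalPower Q α ∈ Matrix.unitaryGroup (Fin d) ℂ := by
  rw [Matrix.mem_unitaryGroup_iff, Matrix.star_eq_conjTranspose,
    fractionalPower_conjTranspose hQ.conjTranspose_eq, fractionalPower_mul hQ.mul_self,
    add_neg_cancel, fractionalPower_zero]

end FractionalPower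

/-! ### Truncated products -/

section TruncatedProd

/-- The part of degree less than `k` in the `b`s of the product of the binomials `a + b`, for the
pairs `(a, b)` of a list. -/
def truncatedProd {R : Type*} [Semiring R] : ℕ → List (R × R) → R
  | 0, _ => 0
  | _ + 1, [] => 1
  | k + 1, p :: l => p.1 * truncatedProd (k + 1) l + p.2 * truncatedProd k l

theorem map_truncatedProd {R S : Type*} [Semiring R] [Semiring S] (f : R →+* S) (k : ℕ)
    (l : List (R × R)) : f (truncatedProd k l) = truncatedProd k (l.map (Prod.map f f)) := by
  induction l generalizing k with
  | nil => cases k <;> simp [truncatedProd]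
  | cons p l ih => cases k <;> simp [truncatedProd, ih]

theorem norm_list_prod_le_one {R : Type*} [SeminormedRing R] (h_one : ‖(1 : R)‖ ≤ 1) {l : List R}
    (hl : ∀ a ∈ l, ‖a‖ ≤ 1) : ‖l.prod‖ ≤ 1 :=
  List.prod_induction (‖·‖ ≤ 1)
    (fun a b ha hb => (norm_mul_le a b).trans (mul_le_one₀ ha (norm_nonneg b) hb)) h_one hl

theorem pow_succ_div_factorial_add_le {x y : ℝ} (hx : 0 ≤ x) (hy : 0 ≤ y) (k : ℕ) :
    x ^ (k + 1) / (k + 1).factorial + y * (x ^ k / k.factorial) ≤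
      (y + x) ^ (k + 1) / (k + 1).factorial := by
  have bernoulli := pow_add_mul_le_add_pow hx (by positivity : 0 ≤ 2 * x + y) (k + 1)
  rw [add_comm y x, le_div_iff₀ (by positivity)]
  refine le_trans (le_of_eq ?_) bernoulli
  rw [Nat.factorial_succ, Nat.add_sub_cancel]
  push_cast
  field_simp

theorem norm_prod_sub_truncatedProd_le {R : Type*} [SeminormedRing R] (h_one : ‖(1 : R)‖ ≤ 1)
    {l : List (R × R)} (hl : ∀ p ∈ l, ‖p.1‖ ≤ 1 ∧ ‖p.1 + p.2‖ ≤ 1) (k : ℕ) :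
    ‖(l.map fun p => p.1 + p.2).prod - truncatedProd k l‖ ≤
      (l.map fun p => ‖p.2‖).sum ^ k / k.factorial := by
  induction l generalizing k with
  | nil => cases k <;> simp [truncatedProd, h_one]
  | cons p l ih =>
    cases k with
    | zero =>
      rw [truncatedProd, sub_zero, pow_zero, Nat.factorial_zero, Nat.cast_one, div_one]
      exact norm_list_prod_le_one h_one (List.forall_mem_map.2 fun p hp => (hl p hp).2)
    | succ k =>
      rw [List.forall_mem_cons] at hl
      set t := (l.map fun p => p.1 + p.2).prod
      set s := (l.map fun p => ‖p.2‖).sum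
      have hs : 0 ≤ s := List.sum_nonneg (List.forall_mem_map.2 fun _ _ => norm_nonneg _)
      calc ‖((p :: l).map fun p => p.1 + p.2).prod - truncatedProd (k + 1) (p :: l)‖
          = ‖p.1 * (t - truncatedProd (k + 1) l) + p.2 * (t - truncatedProd k l)‖ := by
            rw [List.map_cons, List.prod_cons, truncatedProd]
            congr 1
            noncomm_ring
        _ ≤ ‖p.1‖ * ‖t - truncatedProd (k + 1) l‖ + ‖p.2‖ * ‖t - truncatedProd k l‖ :=
            (norm_add_le _ _).trans (add_le_add (norm_mul_le _ _) (norm_mul_le _ _))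
        _ ≤ s ^ (k + 1) / (k + 1).factorial + ‖p.2‖ * (s ^ k / k.factorial) :=
            add_le_add
              ((mul_le_of_le_one_left (norm_nonneg _) hl.1.1).trans (ih hl.2 (k + 1)))
              (mul_le_mul_of_nonneg_left (ih hl.2 k) (norm_nonneg _))
        _ ≤ _ := by
            rw [List.map_cons, List.sum_cons]
            exact pow_succ_div_factorial_add_le hs (norm_nonneg _) k

end TruncatedProd

/-! ### Lists of steps -/

section Steps

variable {η d : ℕ}

/-- The operation performed by a list of steps, the last step first. -/
noncomputable def stepsEval (l : List (FractionalStep η d)) (Q : OracleFamily η d) :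
    Matrix (Fin d) (Fin d) ℂ :=
  (l.map fun s => s.gate.1 * fractionalPower (Q.1 s.oracle) s.exponent).prod

/-- The sum of the exponents of a list of steps. -/
noncomputable def stepsCost (l : List (FractionalStep η d)) : ℝ :=
  (l.map FractionalStep.exponent).sum

theorem stepsEval_cons (s : FractionalStep η d) (l : List (FractionalStep η d))
    (Q : OracleFamily η d) : stepsEval (s :: l) Q =
      s.gate.1 * fractionalPower (Q.1 s.oracle) s.exponent * stepsEval l Q :=
  List.prod_cons

theorem stepsCost_cons (s : FractionalStep η d) (l : List (FractionalStep η d)) :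
    stepsCost (s :: l) = s.exponent + stepsCost l :=
  List.sum_cons

theorem stepsCost_nonneg (l : List (FractionalStep η d)) : 0 ≤ stepsCost l :=
  List.sum_nonneg (List.forall_mem_map.2 fun s _ => s.exponent_pos.le)

theorem stepsEval_mem_unitaryGroup (l : List (FractionalStep η d)) (Q : OracleFamily η d) :
    stepsEval l Q ∈ Matrix.unitaryGroup (Fin d) ℂ :=
  list_prod_mem (List.forall_mem_map.2 fun s _ =>
    mul_mem s.gate.2 (fractionalPower_mem_unitaryGroup (Q.2 s.oracle) s.exponent))

theorem eval_eq_stepsEval_mul_first (A : FractionalQueryAlgorithm η d) (Q : OracleFamily η d) :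
    A.eval Q.1 = stepsEval A.steps.reverse Q * A.first.1 := by
  rw [FractionalQueryAlgorithm.eval]
  generalize A.first.1 = M
  induction A.steps generalizing M with
  | nil => simp [stepsEval]
  | cons s l ih =>
    rw [List.foldl_cons, ih]
    simp [stepsEval, Matrix.mul_assoc]

theorem stepsCost_reverse (l : List (FractionalStep η d)) :
    stepsCost l.reverse = stepsCost l := by
  rw [stepsCost, List.map_reverse, List.sum_reverse, stepsCost]

/-- The two terms into which the operation of a step is expanded: the term without and the term
with the oracle. -/
noncomputable def stepTerms (s : FractionalStep η d) :
    (OracleFamily η d → Matrix (Fin d) (Fin d) ℂ) × (OracleFamily η d → Matrix (Fin d) (Fin d) ℂ) :=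
  (((1 + fractionalPhase s.exponent) / 2) • fun _ => s.gate.1,
    ((1 - fractionalPhase s.exponent) / 2) • fun Q => s.gate.1 * Q.1 s.oracle)

theorem stepTerms_fst_add_snd (s : FractionalStep η d) (Q : OracleFamily η d) :
    (stepTerms s).1 Q + (stepTerms s).2 Q =
      s.gate.1 * fractionalPower (Q.1 s.oracle) s.exponent := by
  simp [stepTerms, fractionalPower_eq, Matrix.mul_add]

theorem norm_stepTerms_fst_le (s : FractionalStep η d) (Q : OracleFamily η d) :
    ‖(stepTerms s).1 Q‖ ≤ 1 := by
  rw [stepTerms]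
  dsimp only [Pi.smul_apply]
  rw [norm_smul]
  exact mul_le_one₀ (norm_one_add_fractionalPhase_le _) (norm_nonneg _)
    (l2_opNorm_le_one_of_mem_unitaryGroup s.gate.2)

theorem norm_stepTerms_snd_le (s : FractionalStep η d) (Q : OracleFamily η d) :
    ‖(stepTerms s).2 Q‖ ≤ Real.pi / 2 * s.exponent := by
  rw [stepTerms]
  dsimp only [Pi.smul_apply]
  rw [norm_smul]
  exact (mul_le_of_le_one_right (norm_nonneg _) (l2_opNorm_le_one_of_mem_unitaryGroup
    (mul_mem s.gate.2 (Q.2 s.oracle).1))).trans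
      (norm_one_sub_fractionalPhase_le s.exponent_pos.le)

theorem norm_stepsEval_sub_truncatedProd_le (k : ℕ) (l : List (FractionalStep η d))
    (Q : OracleFamily η d) :
    ‖stepsEval l Q - truncatedProd k (l.map stepTerms) Q‖ ≤
      (Real.pi / 2 * stepsCost l) ^ k / k.factorial := by
  let terms : FractionalStep η d → Matrix (Fin d) (Fin d) ℂ × Matrix (Fin d) (Fin d) ℂ :=
    fun s => ((stepTerms s).1 Q, (stepTerms s).2 Q)
  have truncatedProd_apply :
      truncatedProd k (l.map stepTerms) Q = truncatedProd k (l.map terms) := by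
    simpa [Function.comp_def, Prod.map, terms] using
      map_truncatedProd (Pi.evalRingHom _ Q) k (l.map stepTerms)
  have prod_eq : stepsEval l Q = ((l.map terms).map fun p => p.1 + p.2).prod := by
    simp [stepsEval, terms, Function.comp_def, stepTerms_fst_add_snd]
  have terms_le : ∀ p ∈ l.map terms, ‖p.1‖ ≤ 1 ∧ ‖p.1 + p.2‖ ≤ 1 := by
    refine List.forall_mem_map.2 fun s _ => ⟨norm_stepTerms_fst_le s Q, ?_⟩
    rw [stepTerms_fst_add_snd]
    exact l2_opNorm_le_one_of_mem_unitaryGroup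
      (mul_mem s.gate.2 (fractionalPower_mem_unitaryGroup (Q.2 _) _))
  have sum_le : ((l.map terms).map fun p => ‖p.2‖).sum ≤ Real.pi / 2 * stepsCost l := by
    rw [stepsCost, ← List.sum_map_mul_left, List.map_map]
    exact List.sum_le_sum fun s _ => norm_stepTerms_snd_le s Q
  rw [truncatedProd_apply, prod_eq]
  refine (norm_prod_sub_truncatedProd_le
    (l2_opNorm_le_one_of_mem_unitaryGroup (one_mem _)) terms_le k).trans ?_
  gcongr
  exact List.sum_nonneg (List.forall_mem_map.2 fun _ _ => norm_nonneg _)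

theorem norm_add_norm_coefficients_le_exp {α : ℝ} (hα : 0 ≤ α) :
    ‖(1 + fractionalPhase α) / 2‖ + ‖(1 - fractionalPhase α) / 2‖ ≤ Real.exp (Real.pi / 2 * α) := by
  linarith [norm_one_add_fractionalPhase_le α, norm_one_sub_fractionalPhase_le hα,
    Real.add_one_le_exp (Real.pi / 2 * α)]

theorem truncatedProd_stepTerms_mem (i₀ : Fin η) (k : ℕ) (l : List (FractionalStep η d)) :
    truncatedProd k (l.map stepTerms) ∈
      Real.exp (Real.pi / 2 * stepsCost l) • convexHull ℝ (targetComputable d i₀ k) := by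
  have one_mem_hull (k : ℕ) : 1 ∈ convexHull ℝ (targetComputable d i₀ k) :=
    subset_convexHull ℝ _ (one_mem_targetComputable i₀ k)
  induction l generalizing k with
  | nil =>
    have zero_mem_hull := balanced_convexHull_exactlyComputable.zero_mem ⟨1, one_mem_hull k⟩
    cases k with
    | zero => simpa [truncatedProd, stepsCost] using zero_mem_hull
    | succ k => simpa [truncatedProd, stepsCost] using one_mem_hull (k + 1)
  | cons s l ih =>
    cases k with
    | zero =>
      exact ⟨0, balanced_convexHull_exactlyComputable.zero_mem ⟨1, one_mem_hull 0⟩, smul_zero _⟩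
    | succ k =>
      have gate_mem := gate_mem_targetComputable i₀ s.gate
      have oracle_mem :=
        mul_mem_exactlyComputable gate_mem (oracle_mem_targetComputable i₀ s.oracle)
      have without_oracle := smul_mul_mem_smul_convexHull_exactlyComputable gate_mem (ih (k + 1))
        ((1 + fractionalPhase s.exponent) / 2)
      have with_oracle := smul_mul_mem_smul_convexHull_exactlyComputable oracle_mem (ih k)
        ((1 - fractionalPhase s.exponent) / 2)
      rw [zero_add] at without_oracle
      rw [zero_add, add_comm 1 k] at with_oracle
      have sum_mem := Set.add_mem_add without_oracle with_oracle
      rw [← (convex_convexHull ℝ _).add_smul (by positivity) (by positivity), ← add_mul] at sum_mem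
      refine smul_set_mono_of_balanced balanced_convexHull_exactlyComputable ?_ sum_mem
      rw [abs_of_nonneg (by positivity), abs_of_nonneg (by positivity), stepsCost_cons, mul_add,
        Real.exp_add]
      exact mul_le_mul_of_nonneg_right (norm_add_norm_coefficients_le_exp s.exponent_pos.le)
        (Real.exp_nonneg _)

/-- The isometry `|0⟩|0⟩|i₀⟩ ⊗ 1` from the target system to all registers, for a work register with
`N + 1` basis states. -/
noncomputable def registerEmbedding (d N : ℕ) (i₀ : Fin η) :
    Matrix (Register (Fin (N + 1)) η d) (Fin d) ℂ :=
  ketTensor (Pi.single 0 1) (targetEmbedding d 0 i₀)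

theorem registerEmbedding_conjTranspose_mul_self (N : ℕ) (i₀ : Fin η) :
    (registerEmbedding d N i₀)ᴴ * registerEmbedding d N i₀ = 1 :=
  ketTensor_single_isometry (targetEmbedding_conjTranspose_mul_self 0 i₀) 0

theorem queryGate_conjTranspose (Work : Type) [Fintype Work] [DecidableEq Work]
    (Q : OracleFamily η d) : (queryGate Work Q.1)ᴴ = queryGate Work Q.1 := by
  rw [queryGate_eq_kronecker, Matrix.conjTranspose_kronecker, Matrix.conjTranspose_one,
    controlledOracle_conjTranspose Q.2]

theorem queryGate_mem_unitaryGroup (Work : Type) [Fintype Work] [DecidableEq Work]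
    (Q : OracleFamily η d) :
    queryGate Work Q.1 ∈ Matrix.unitaryGroup (Register Work η d) ℂ := by
  rw [queryGate_eq_kronecker]
  exact Matrix.kronecker_mem_unitary (one_mem _) (controlledOracle_mem_unitaryGroup Q.2)

theorem gate_isSimulable (N : ℕ) (i₀ : Fin η) (U : Matrix.unitaryGroup (Fin d) ℂ) :
    IsSimulable (fun Q : OracleFamily η d => queryGate (Fin (N + 1)) Q.1)
      (registerEmbedding d N i₀) 0 (fun _ => U.1) 0 := by
  refine .of_mem_exactlyComputable (const_mem_exactlyComputable (P := 1 ⊗ₖ (1 ⊗ₖ (1 ⊗ₖ U.1))) ?_ ?_)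
  · exact Matrix.kronecker_mem_unitary (one_mem _) (Matrix.kronecker_mem_unitary
      (one_mem _) (Matrix.kronecker_mem_unitary (one_mem _) U.2))
  · simp only [registerEmbedding, targetEmbedding, kronecker_mul_ketTensor, ← ketTensor_mul,
      Matrix.one_mulVec, Matrix.one_mul, Matrix.mul_one]

theorem eventually_isSimulable_of_cost_le (i₀ : Fin η) (k : ℕ) {l : List (FractionalStep η d)}
    (hl : stepsCost l ≤ 1 / 4) :
    ∀ᶠ N : ℕ in atTop, IsSimulable (fun Q => queryGate (Fin (N + 1)) Q.1)
      (registerEmbedding d N i₀) (3 * k) (stepsEval l) (4 * (1 / k.factorial)) := by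
  have hx : 0 ≤ Real.pi / 2 * stepsCost l := mul_nonneg (by positivity) (stepsCost_nonneg l)
  have hx_half : Real.pi / 2 * stepsCost l ≤ 1 / 2 := by
    nlinarith [Real.pi_lt_four, Real.pi_pos]
  have exp_le_two : Real.exp (Real.pi / 2 * stepsCost l) ≤ 2 := by
    refine (Real.exp_le_exp.2 (hx_half.trans ?_)).trans_eq (Real.exp_log two_pos)
    linarith [Real.log_two_gt_d9]
  have one_le_factorial : (1 : ℝ) ≤ k.factorial := by exact_mod_cast k.factorial_pos
  have truncation_error (Q : OracleFamily η d) :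
      ‖stepsEval l Q - truncatedProd k (l.map stepTerms) Q‖ ≤ 1 / k.factorial :=
    (norm_stepsEval_sub_truncatedProd_le k l Q).trans
      (div_le_div_of_nonneg_right (pow_le_one₀ hx (by linarith)) (Nat.cast_nonneg _))
  have half_mem_hull : (1 / 2 : ℂ) • truncatedProd k (l.map stepTerms) ∈
      convexHull ℝ (targetComputable d i₀ k) := by
    have h := smul_mem_norm_mul_smul_of_balanced balanced_convexHull_exactlyComputable
      (truncatedProd_stepTerms_mem i₀ k l) (1 / 2)
    have h_one := smul_set_mono_of_balanced balanced_convexHull_exactlyComputable (t := 1) ?_ h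
    · rwa [one_smul] at h_one
    · rw [norm_div, norm_one, Complex.norm_ofNat, abs_one, abs_of_nonneg (by positivity)]
      linarith
  filter_upwards [eventually_isBlockEncodable (targetEmbedding_conjTranspose_mul_self 0 i₀)
    half_mem_hull] with N hN
  simp only [← queryGate_eq_kronecker] at hN
  exact hN.isSimulable (queryGate_mem_unitaryGroup _) (queryGate_conjTranspose _)
    (registerEmbedding_conjTranspose_mul_self N i₀) (stepsEval_mem_unitaryGroup l)
    ((div_le_one (by linarith)).2 one_le_factorial) truncation_error

theorem exists_split_of_cost_le {c b : ℝ} (hc : 0 ≤ c) (hb : 0 ≤ b) {l : List (FractionalStep η d)}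
    (hl : stepsCost l ≤ c + b) :
    ∃ l₁ l₂ : List (FractionalStep η d), stepsCost l₁ ≤ c ∧ stepsCost l₂ ≤ b ∧
      ∀ Q, stepsEval l Q = stepsEval l₁ Q * stepsEval l₂ Q := by
  induction l generalizing c with
  | nil => exact ⟨[], [], hc, hb, fun _ => (one_mul 1).symm⟩
  | cons s l ih =>
    rw [stepsCost_cons] at hl
    rcases le_or_gt s.exponent c with hs | hs
    · obtain ⟨l₁, l₂, h₁, h₂, h⟩ := ih (sub_nonneg.2 hs) (by linarith)
      refine ⟨s :: l₁, l₂, ?_, h₂, fun Q => ?_⟩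
      · rw [stepsCost_cons]
        linarith
      · simp only [stepsEval_cons, h, Matrix.mul_assoc]
    rcases hc.eq_or_lt with rfl | hc
    · exact ⟨[], s :: l, le_rfl, by rw [stepsCost_cons]; linarith, fun Q => (one_mul _).symm⟩
    · -- `s` itself is cut into two, the gate staying with the part that is applied last
      have hs_one := s.exponent_le_one
      let head : FractionalStep η d := ⟨c, hc, by linarith, s.oracle, s.gate⟩
      let tail : FractionalStep η d := ⟨s.exponent - c, by linarith, by linarith, s.oracle, 1⟩
      refine ⟨[head], tail :: l, by simp [stepsCost, head], ?_, fun Q => ?_⟩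
      · rw [stepsCost_cons]
        linarith
      · have h := fractionalPower_mul (Q.2 s.oracle).mul_self c (s.exponent - c)
        rw [add_sub_cancel] at h
        simp only [stepsEval_cons, head, tail, ← h]
        simp [stepsEval, Matrix.mul_assoc]

theorem eventually_isSimulable_stepsEval (i₀ : Fin η) (k n : ℕ) {l : List (FractionalStep η d)}
    (hl : stepsCost l ≤ n * (1 / 4)) :
    ∀ᶠ N : ℕ in atTop, IsSimulable (fun Q => queryGate (Fin (N + 1)) Q.1)
      (registerEmbedding d N i₀) (n * (3 * k)) (stepsEval l) (n * (4 * (1 / k.factorial))) := by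
  induction n generalizing l with
  | zero =>
    have hl_nil : l = [] := by
      cases l with
      | nil => rfl
      | cons s l =>
        rw [stepsCost_cons, Nat.cast_zero, zero_mul] at hl
        linarith [s.exponent_pos, stepsCost_nonneg l]
    subst hl_nil
    rw [Nat.zero_mul, Nat.cast_zero, zero_mul]
    exact .of_forall fun N => gate_isSimulable N i₀ 1
  | succ n ih =>
    rw [Nat.cast_succ, add_one_mul] at hl
    obtain ⟨l₁, l₂, h₁, h₂, h⟩ := exists_split_of_cost_le (by positivity) (by norm_num) hl
    filter_upwards [ih h₁, eventually_isSimulable_of_cost_le i₀ k h₂] with N hN₁ hN₂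
    rw [Nat.succ_mul, Nat.cast_succ, add_one_mul, funext h]
    exact hN₁.mul (queryGate_mem_unitaryGroup _) hN₂ (stepsEval_mem_unitaryGroup l₂)

theorem IsSimulable.exists_queryCircuit {N k : ℕ} {i₀ : Fin η}
    {V : OracleFamily η d → Matrix (Fin d) (Fin d) ℂ} {δ : ℝ}
    (hV : IsSimulable (fun Q => queryGate (Fin (N + 1)) Q.1) (registerEmbedding d N i₀) k V δ) :
    ∃ C : QueryCircuit η d, C.queries = k ∧
      ∀ Q : OracleFamily η d, C.Implements Q.1 (V Q) δ := by
  obtain ⟨F, hF, h⟩ := hV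
  obtain ⟨U, l, hl, hU⟩ := hF.exists_list
  let C : QueryCircuit η d := ⟨Fin (N + 1), 0, 0, i₀, U, l⟩
  have embed_eq (φ : Fin d → ℂ) : C.embed φ = registerEmbedding d N i₀ *ᵥ φ := by
    ext ⟨(w : Fin (N + 1)), c, i, x⟩
    change (if w = 0 ∧ c = 0 ∧ i = i₀ then φ x else 0) = _
    simp only [registerEmbedding, targetEmbedding, ketTensor, Matrix.mulVec, dotProduct]
    by_cases hw : w = 0 <;> by_cases hc : c = 0 <;> by_cases hi : i = i₀ <;>
      simp [hw, hc, hi, Matrix.one_apply]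
  refine ⟨C, hl, fun Q ψ hψ => ?_⟩
  have eval_eq : C.eval Q.1 = F Q := hU Q
  rw [embed_eq, embed_eq, eval_eq, Matrix.mulVec_mulVec, Matrix.mulVec_mulVec, ← Matrix.sub_mulVec]
  refine (Matrix.l2_opNorm_mulVec _ (WithLp.toLp 2 ψ)).trans ?_
  rw [hψ, mul_one]
  exact h Q

theorem exists_queryCircuit_of_cost_le (A : FractionalQueryAlgorithm η d) (i₀ : Fin η) (k : ℕ)
    {n : ℕ} (hA : A.cost ≤ n * (1 / 4)) :
    ∃ C : QueryCircuit η d, C.queries = n * (3 * k) ∧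
      ∀ Q : OracleFamily η d, C.Implements Q.1 (A.eval Q.1) (n * (4 * (1 / k.factorial))) := by
  obtain ⟨N, hN⟩ := (eventually_isSimulable_stepsEval i₀ k n
    ((stepsCost_reverse A.steps).trans_le hA)).exists
  have h := hN.mul (queryGate_mem_unitaryGroup _) (gate_isSimulable N i₀ A.first)
    (fun _ => A.first.2)
  rw [add_zero, add_zero] at h
  obtain ⟨C, hC, hC_implements⟩ := h.exists_queryCircuit
  refine ⟨C, hC, fun Q => ?_⟩
  rw [eval_eq_stepsEval_mul_first]
  exact hC_implements Q

theorem nonempty_of_cost_pos {A : FractionalQueryAlgorithm η d} (hA : 0 < A.cost) :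
    Nonempty (Fin η) := by
  obtain ⟨s, -⟩ := List.exists_mem_of_ne_nil A.steps fun h =>
    hA.ne' (by simp [FractionalQueryAlgorithm.cost, h])
  exact ⟨s.oracle⟩

end Steps

/-! ### The number of queries -/

theorem exp_mul_le_factorial {k : ℕ} {c : ℝ} (hk : Real.exp (1 + c) ≤ k) :
    Real.exp (k * c) ≤ k.factorial := by
  have pow_le : (k : ℝ) ^ k ≤ Real.exp k * k.factorial := by
    rw [← div_le_iff₀ (by positivity)]
    exact Real.pow_div_factorial_le_exp (k : ℝ) (Nat.cast_nonneg k) k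
  refine le_of_mul_le_mul_left ?_ (Real.exp_pos k)
  calc Real.exp k * Real.exp (k * c) = Real.exp (1 + c) ^ k := by
        rw [← Real.exp_add, ← Real.exp_nat_mul, mul_add, mul_one]
    _ ≤ (k : ℝ) ^ k := pow_le_pow_left₀ (Real.exp_nonneg _) hk k
    _ ≤ Real.exp k * k.factorial := pow_le

theorem exp_one_add_half_log_le {x : ℝ} (hx : 1 < x) :
    Real.exp (1 + Real.log x / 2) ≤ 2 * (x / Real.log x) := by
  have hlog : 0 < Real.log x := Real.log_pos hx
  have exp_one_mul_le : Real.exp 1 * (Real.log x / 2) ≤ Real.exp (Real.log x / 2) := by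
    have h := Real.add_one_le_exp (Real.log x / 2 - 1)
    rwa [sub_add_cancel, Real.exp_sub, le_div_iff₀' (Real.exp_pos 1)] at h
  rw [mul_div_assoc', le_div_iff₀ hlog]
  calc Real.exp (1 + Real.log x / 2) * Real.log x
      = 2 * (Real.exp (Real.log x / 2) * (Real.exp 1 * (Real.log x / 2))) := by
        rw [Real.exp_add]
        ring
    _ ≤ 2 * (Real.exp (Real.log x / 2) * Real.exp (Real.log x / 2)) := by gcongr
    _ = 2 * x := by rw [← Real.exp_add, add_halves, Real.exp_log (by linarith)]

theorem exists_factorial_ge {y : ℝ} (hy : Real.exp 1 < y) :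
    ∃ k : ℕ, (k : ℝ) ≤ 11 * (Real.log y / Real.log (Real.log y)) ∧ 20 * y ≤ k.factorial := by
  have hy_pos : 0 < y := (Real.exp_pos 1).trans hy
  set L := Real.log y with hL
  have hL_one : 1 < L := by rwa [hL, Real.lt_log_iff_exp_lt hy_pos]
  have hlog : 0 < Real.log L := Real.log_pos hL_one
  have exp_le := exp_one_add_half_log_le hL_one
  have one_le_ratio : 1 ≤ L / Real.log L :=
    (one_le_div hlog).2 ((Real.log_le_sub_one_of_pos (by linarith)).trans (by linarith))
  set k := ⌈10 * (L / Real.log L)⌉₊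
  have le_k : 10 * (L / Real.log L) ≤ k := Nat.le_ceil _
  refine ⟨k, ?_, ?_⟩
  · linarith [Nat.ceil_lt_add_one (show 0 ≤ 10 * (L / Real.log L) by linarith)]
  have five_mul_le : 5 * L ≤ k * (Real.log L / 2) := by
    calc 5 * L = 10 * (L / Real.log L) * (Real.log L / 2) := by field_simp; norm_num
      _ ≤ k * (Real.log L / 2) := by gcongr
  have twenty_le : (20 : ℝ) ≤ Real.exp (4 * L) := by
    calc (20 : ℝ) ≤ 2.7 ^ 4 := by norm_num
      _ ≤ Real.exp 1 ^ 4 := by gcongr; linarith [Real.exp_one_gt_d9]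
      _ = Real.exp 4 := by rw [← Real.exp_nat_mul]; norm_num
      _ ≤ Real.exp (4 * L) := Real.exp_le_exp.2 (by linarith)
  calc 20 * y ≤ Real.exp (4 * L) * Real.exp L := by
        rw [hL, Real.exp_log hy_pos, ← hL]
        gcongr
    _ = Real.exp (5 * L) := by rw [← Real.exp_add]; ring_nf
    _ ≤ Real.exp (k * (Real.log L / 2)) := Real.exp_le_exp.2 five_mul_le
    _ ≤ k.factorial := exp_mul_le_factorial (by linarith)

theorem mainTheorem7 :
    ∃ K : ℝ, 0 < K ∧
      ∀ (η d : ℕ) (A : FractionalQueryAlgorithm η d) (T ε : ℝ),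
        A.cost = T → 1 ≤ T → 0 < ε → Real.exp 1 < T / ε →
        ∃ C : QueryCircuit η d,
          (C.queries : ℝ) ≤ K * (T * (Real.log (T / ε) / Real.log (Real.log (T / ε)))) ∧
          ∀ Q : Fin η → Matrix (Fin d) (Fin d) ℂ, (∀ j, IsSignOracle (Q j)) →
            C.Implements Q (A.eval Q) ε := by
  refine ⟨165, by norm_num, fun η d A T ε hA hT hε hTε => ?_⟩
  obtain ⟨i₀⟩ := nonempty_of_cost_pos (A := A) (by linarith)
  obtain ⟨k, k_le, factorial_ge⟩ := exists_factorial_ge hTε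
  rw [mul_div_assoc', div_le_iff₀ hε] at factorial_ge
  have hT_le : 4 * T ≤ ⌈4 * T⌉₊ := Nat.le_ceil _
  have hceil : (⌈4 * T⌉₊ : ℝ) ≤ 5 * T := by
    linarith [Nat.ceil_lt_add_one (show 0 ≤ 4 * T by linarith)]
  obtain ⟨C, queries_eq, hC⟩ := exists_queryCircuit_of_cost_le A i₀ k (n := ⌈4 * T⌉₊) (by linarith)
  refine ⟨C, ?_, fun Q hQ ψ hψ => (hC ⟨Q, hQ⟩ ψ hψ).trans ?_⟩
  · rw [queries_eq]
    push_cast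
    calc (⌈4 * T⌉₊ : ℝ) * (3 * k)
        ≤ 5 * T * (3 * (11 * (Real.log (T / ε) / Real.log (Real.log (T / ε))))) := by gcongr
      _ = 165 * (T * (Real.log (T / ε) / Real.log (Real.log (T / ε)))) := by ring
  · calc (⌈4 * T⌉₊ : ℝ) * (4 * (1 / k.factorial)) ≤ 5 * T * (4 * (1 / k.factorial)) := by gcongr
      _ = 20 * T / k.factorial := by ring
      _ ≤ ε := (div_le_iff₀' (by positivity)).2 factorial_ge
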